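/- Let $q\ge 2$, $n\ge 0$, $t\ge 1$ and $s\ge 0$ be integers and let $\Sigma_q=\{0,1,\dots,q-1\}$. For $x=(x_1,\dots,x_n)\in\Sigma_q^n$ put $x_0=0$, let $d(x)_i\in\{0,\dots,q-1\}$ be the residue of $x_i-x_{i-1}$ modulo $q$, and let $g(x)_i=\sum_{j=1}^{i}d(x)_j\in\mathbb{Z}$ for $1\le i\le n$. For $z\in\mathbb{Z}^n$ and an integer $k\ge 0$ let $\mathrm{VT}^k(z)=\sum_{i=1}^n i^k z_i$. Call $x\in\Sigma_q^n$ $t$-valid if any two adjacent non-zero entries of $x$ (non-zero entries with only zeros between them) are at positions whose distance is at least $t+1$. **Theorem.** For $0\le k\le 2t+2s-2$ let $n_k=q(2t+2s-1)\sum_{i=1}^n i^k$ and let $a_k$ be an integer with $0\le a_k\le n_k$. Then the code $$\mathcal{C}=\bigl\{x\in\Sigma_q^n:\ x\text{ is }t\text{-valid and }\mathrm{VT}^k(g(x))\equiv a_k \pmod{n_k+1}\text{ for all }0\le k\le 2t+2s-2\bigr\}$$ is a $q$-ary $t$-deletion $s$-substitution correcting code: for any two distinct $x,y\in\mathcal{C}$,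 no sequence can be obtained both from $x$ and from $y$ by exactly $t$ deletions and $s$ substitutions (in any order), where a deletion removes one symbol and a substitution replaces one symbol by an arbitrary symbol of $\Sigma_q$, possibly the same one. -/

import Mathlib

namespace DelSub

/-- `ErrorPath t s x z`: the sequence `z` is obtained from the sequence `x` by exactly `t` deletions
and `s` substitutions, carried out one at a time in an arbitrary order. A substitution replaces one
symbol by any symbol of the alphabet (possibly the same one). -/
inductive ErrorPath {α : Type*} : ℕ → ℕ → List α → List α → Prop
  | refl (x : List α) : ErrorPath 0 0 x x
  | deletion {t s : ℕ} {z : List α} (u v : List α) (a : α) :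
      ErrorPath t s (u ++ v) z → ErrorPath (t + 1) s (u ++ a :: v) z
  | substitution {t s : ℕ} {z : List α} (u v : List α) (a b : α) :
      ErrorPath t s (u ++ b :: v) z → ErrorPath t (s + 1) (u ++ a :: v) z

/-- The `t`-deletion `s`-substitution ball of a sequence of length `n`. -/
def errorBall {α : Type*} {n : ℕ} (t s : ℕ) (x : Fin n → α) : Set (List α) :=
  {z | ErrorPath t s (List.ofFn x) z}

/-- A code corrects `t` deletions and `s` substitutions if the `t`-deletion `s`-substitution balls
of any two distinct codewords are disjoint. -/
def IsCorrectingCode {α : Type*} {n : ℕ} (t s : ℕ) (C : Set (Fin n → α)) : Prop :=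
  ∀ x ∈ C, ∀ y ∈ C, x ≠ y → Disjoint (errorBall t s x) (errorBall t s y)

/-- The symbol preceding position `i`, where the symbol before the first one is `0`. -/
def prevSymbol {q n : ℕ} (x : Fin n → Fin q) (i : Fin n) : ℕ :=
  if (i : ℕ) = 0 then 0 else (x ⟨(i : ℕ) - 1, by omega⟩ : ℕ)

/-- The differential sequence: `d(x)_i` is the residue of `x_i - x_{i-1}` modulo `q`
in `{0, …, q - 1}`, taken as an integer. -/
def diffSeq {q n : ℕ} (x : Fin n → Fin q) (i : Fin n) : ℤ :=
  (((x i : ℕ) : ℤ) - (prevSymbol x i : ℤ)) % (q : ℤ)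

/-- The accumulative differential sequence `g(x)_i = d(x)_1 + ⋯ + d(x)_i`, a sum of integers. -/
def accDiffSeq {q n : ℕ} (x : Fin n → Fin q) (i : Fin n) : ℤ :=
  ∑ j ∈ Finset.Iic i, diffSeq x j

/-- The `k`-th order VT syndrome `∑ i ^ k * z_i`; positions are counted from `1`. -/
def vtSyndrome {n : ℕ} (k : ℕ) (z : Fin n → ℤ) : ℤ :=
  ∑ i : Fin n, (((i : ℕ) : ℤ) + 1) ^ k * z i

/-- A `q`-ary sequence is `t`-valid if any two adjacent non-zero entries (that is, with only zeros
between them) are at distance at least `t + 1`. -/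
def IsValid {q n : ℕ} (t : ℕ) (x : Fin n → Fin q) : Prop :=
  ∀ i j : Fin n, i < j → (x i : ℕ) ≠ 0 → (x j : ℕ) ≠ 0 →
    (∀ l : Fin n, i < l → l < j → (x l : ℕ) = 0) → t + 1 ≤ (j : ℕ) - (i : ℕ)

/-- The number `n_k = q (2t + 2s - 1) (1 ^ k + ⋯ + n ^ k)`. -/
def nBound (q n t s k : ℕ) : ℕ :=
  q * (2 * t + 2 * s - 1) * ∑ i ∈ Finset.Icc 1 n, i ^ k

/-- The `t`-valid sequences whose accumulative differential sequences have prescribed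
VT syndromes of orders `0, …, 2t + 2s - 2`, modulo `n_k + 1`. -/
def validVTCode (q n t s : ℕ) (a : ℕ → ℕ) : Set (Fin n → Fin q) :=
  {x | IsValid t x ∧ ∀ k ∈ Finset.Icc 0 (2 * t + 2 * s - 2),
    vtSyndrome k (accDiffSeq x) ≡ (a k : ℤ) [ZMOD ((nBound q n t s k + 1 : ℕ) : ℤ)]}

end DelSub

/-! ### Sign blocks, counts of non-zero symbols and spaced words. -/

namespace DelSub

/-! A non-zero symbol followed by a zero adds exactly `q` to the accumulated differences. Hence `F =
g(x) - g(y)` is `accDiff`, whose sign is that of the difference of the non-zero counts, or of `x i -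
y i` when the counts agree.

A common output yields an alignment of `x` and `y` with `t` unmatched symbols on each side and at
most `2s` mismatches. Let `D` be the number of non-zero symbols read in `x` minus that in `y`, with
`y` ahead. The offset is at most `t`, so the window by which `y` leads holds at most one non-zero
symbol. Matches preserve `D`, and at a match `F` is weakly positive if `D ≥ 0` and weakly negative
if `D < 0`; with no offset and `D = 0` it vanishes. So new sign blocks are paid for by errors, and
closing an offset saves one unit (`Reach.inv`): there are at most `2t + 2s - 1` blocks.

A non-zero `F` then has the signs of a polynomial of degree at most `2t + 2s - 2`
(`exists_polynomial_sign`), so vanishing moments force `F = 0` (`eq_zero_of_moments`). The bound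
`|F| ≤ q(t + 2s)` turns the syndrome congruences into equalities. -/

/-- The number of non-zero symbols among the first `i` symbols. -/
def numNonzero (x : ℕ → ℕ) (i : ℕ) : ℤ := ∑ l ∈ Finset.range i, if x l = 0 then 0 else 1

/-- The difference of the accumulative differential sequences of `x` and `y`, for words whose
non-zero symbols are isolated. -/
def accDiff (q : ℕ) (x y : ℕ → ℕ) (i : ℕ) : ℤ :=
  (x i : ℤ) - y i + q * (numNonzero x i - numNonzero y i)

/-- The number of maximal blocks of constant sign (zeros disregarded) of `F` on `[0, m)`, together
with the sign of the last block. -/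
def signBlocks (F : ℕ → ℤ) : ℕ → ℕ × ℤ
  | 0 => (0, 0)
  | m + 1 => if F m = 0 ∨ (F m).sign = (signBlocks F m).2 then signBlocks F m
      else ((signBlocks F m).1 + 1, (F m).sign)

theorem signBlocks_succ (F : ℕ → ℤ) (m : ℕ) :
    (F m = 0 ∧ (signBlocks F (m + 1)).1 = (signBlocks F m).1 ∧
      (signBlocks F (m + 1)).2 = (signBlocks F m).2) ∨
    (0 < F m ∧ (signBlocks F (m + 1)).2 = 1 ∧
      (((signBlocks F m).2 = 1 ∧ (signBlocks F (m + 1)).1 = (signBlocks F m).1) ∨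
       ((signBlocks F m).2 ≠ 1 ∧ (signBlocks F (m + 1)).1 = (signBlocks F m).1 + 1))) ∨
    (F m < 0 ∧ (signBlocks F (m + 1)).2 = -1 ∧
      (((signBlocks F m).2 = -1 ∧ (signBlocks F (m + 1)).1 = (signBlocks F m).1) ∨
       ((signBlocks F m).2 ≠ -1 ∧ (signBlocks F (m + 1)).1 = (signBlocks F m).1 + 1))) := by
  rcases lt_trichotomy (F m) 0 with h | h | h
  · right; right
    simp only [signBlocks, Int.sign_eq_neg_one_of_neg h, h.ne, false_or]
    split_ifs with h2
    · exact ⟨h, h2.symm, Or.inl ⟨h2.symm, rfl⟩⟩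
    · exact ⟨h, rfl, Or.inr ⟨Ne.symm h2, rfl⟩⟩
  · left
    simp [signBlocks, h]
  · right; left
    simp only [signBlocks, Int.sign_eq_one_of_pos h, h.ne', false_or]
    split_ifs with h2
    · exact ⟨h, h2.symm, Or.inl ⟨h2.symm, rfl⟩⟩
    · exact ⟨h, rfl, Or.inr ⟨Ne.symm h2, rfl⟩⟩

theorem signBlocks_neg (F : ℕ → ℤ) (m : ℕ) :
    (signBlocks (fun i => -F i) m).1 = (signBlocks F m).1 ∧
      (signBlocks (fun i => -F i) m).2 = -(signBlocks F m).2 := by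
  induction m with
  | zero => simp [signBlocks]
  | succ m ih =>
    have h1 := signBlocks_succ F m
    have h2 := signBlocks_succ (fun i => -F i) m
    omega

theorem accDiff_swap (q : ℕ) (x y : ℕ → ℕ) : accDiff q y x = fun i => -accDiff q x y i := by
  funext i; simp only [accDiff]; ring

theorem numNonzero_succ (x : ℕ → ℕ) (i : ℕ) :
    (x i = 0 ∧ numNonzero x (i + 1) = numNonzero x i) ∨
      (x i ≠ 0 ∧ numNonzero x (i + 1) = numNonzero x i + 1) := by
  rw [numNonzero, Finset.sum_range_succ, ← numNonzero]
  by_cases h : x i = 0 <;> simp [h]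

/-- Any two non-zero symbols are at distance more than `t`. -/
def Spaced (t : ℕ) (x : ℕ → ℕ) : Prop := ∀ i j, i < j → j ≤ i + t → x i ≠ 0 → x j = 0

/-- A non-zero symbol in so short a stretch is within distance `t` of everything after it up to `j`,
so it is the only one and `y j` vanishes too. -/
theorem Spaced.window {t : ℕ} {y : ℕ → ℕ} (hy : Spaced t y) {i j : ℕ} (hij : i ≤ j)
    (hj : j ≤ i + t) :
    (numNonzero y j = numNonzero y i ∧ ∀ p, i ≤ p → p < j → y p = 0) ∨
      (numNonzero y j = numNonzero y i + 1 ∧ y j = 0 ∧ ∃ p, i ≤ p ∧ p < j ∧ y p ≠ 0) := by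
  induction j, hij using Nat.le_induction with
  | base => left; exact ⟨rfl, fun p h1 h2 => absurd h1 (by omega)⟩
  | succ j hij ih =>
    have hs := numNonzero_succ y j
    rcases ih (by omega) with ⟨h1, h2⟩ | ⟨h1, h2, p, hp1, hp2, hp3⟩
    · rcases hs with ⟨h3, h4⟩ | ⟨h3, h4⟩
      · left
        refine ⟨by omega, fun p hp1 hp2 => ?_⟩
        rcases Nat.lt_succ_iff_lt_or_eq.mp hp2 with h | rfl
        · exact h2 p hp1 h
        · exact h3
      · right
        exact ⟨by omega, hy j (j + 1) (by omega) (by omega) h3, j, hij, by omega, h3⟩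
    · right
      exact ⟨by omega, hy p (j + 1) (by omega) (by omega) hp3, p, hp1, by omega, hp3⟩

theorem accDiff_cases {q : ℕ} {x y : ℕ → ℕ} {i : ℕ} (hx : x i < q) (hy : y i < q) :
    (1 ≤ numNonzero x i - numNonzero y i → 0 < accDiff q x y i) ∧
    (numNonzero x i - numNonzero y i ≤ -1 → accDiff q x y i < 0) ∧
    (numNonzero x i - numNonzero y i = 0 → accDiff q x y i = (x i : ℤ) - y i) := by
  simp only [accDiff]
  generalize numNonzero x i - numNonzero y i = k
  have hx' : (x i : ℤ) < q := by exact_mod_cast hx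
  have hy' : (y i : ℤ) < q := by exact_mod_cast hy
  refine ⟨fun h => by nlinarith, fun h => by nlinarith, fun h => by simp [h]⟩

/-- Since `|x i - y i| < q`, the symbols matter only when the count difference is extreme; there
they must not push outwards. -/
theorem accDiff_abs_le {q : ℕ} {x y : ℕ → ℕ} {i : ℕ} (hx : x i < q) (hy : y i < q) {K : ℤ}
    (h1 : numNonzero x i - numNonzero y i ≤ K)
    (h2 : numNonzero x i - numNonzero y i = K → x i ≤ y i)
    (h3 : -K ≤ numNonzero x i - numNonzero y i)
    (h4 : numNonzero x i - numNonzero y i = -K → y i ≤ x i) : |accDiff q x y i| ≤ q * K := by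
  simp only [accDiff]
  generalize numNonzero x i - numNonzero y i = k at *
  have hx' : (x i : ℤ) < q := by exact_mod_cast hx
  have hy' : (y i : ℤ) < q := by exact_mod_cast hy
  rw [abs_le]
  constructor
  · rcases eq_or_lt_of_le h3 with h | h
    · have : (y i : ℤ) ≤ x i := by exact_mod_cast h4 h.symm
      rw [← h]; linarith
    · have : (q : ℤ) * (-K + 1) ≤ q * k := by gcongr; omega
      linarith
  · rcases eq_or_lt_of_le h1 with h | h
    · have : (x i : ℤ) ≤ y i := by exact_mod_cast h2 h
      rw [h]; linarith
    · have : (q : ℤ) * (k + 1) ≤ q * K := by gcongr; omega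
      linarith

/-! ### Sign blocks along an alignment. -/

/-- `Reach x y i j a b w`: the first `i` symbols of `x` and the first `j` symbols of `y` have an
alignment with `a` unmatched symbols of `x`, `b` unmatched symbols of `y`, and at most `w` pairs of
different symbols. -/
inductive Reach (x y : ℕ → ℕ) : ℕ → ℕ → ℕ → ℕ → ℕ → Prop
  | start : Reach x y 0 0 0 0 0
  | same {i j a b w : ℕ} : Reach x y i j a b w → x i = y j → Reach x y (i + 1) (j + 1) a b w
  | sub {i j a b w : ℕ} : Reach x y i j a b w → Reach x y (i + 1) (j + 1) a b (w + 1)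
  | delLeft {i j a b w : ℕ} : Reach x y i j a b w → Reach x y (i + 1) j (a + 1) b w
  | delRight {i j a b w : ℕ} : Reach x y i j a b w → Reach x y i (j + 1) a (b + 1) w

/-- Among the symbols at positions in `[i, j)`, some non-zero symbol of `x` is not behind some
non-zero symbol of `y`. -/
def Pending (x y : ℕ → ℕ) (i j : ℕ) : Prop := ∃ l p, i ≤ l ∧ l ≤ p ∧ p < j ∧ x l ≠ 0 ∧ y p ≠ 0

/-- The invariant of an alignment in which `y` is ahead of `x`: the number of sign blocks of
`accDiff q x y` is bounded by the cost of the alignment, with a gain that depends on the balance of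
non-zero symbols. -/
structure Inv (q t s : ℕ) (x y : ℕ → ℕ) (i j a b w : ℕ) : Prop where
  le : i ≤ j
  len : j + a = i + b
  upper : numNonzero x i - numNonzero y j ≤ a + w
  lower : -(numNonzero x i - numNonzero y j) ≤ b + w
  upper_pending : Pending x y i j → numNonzero x i - numNonzero y j + 1 ≤ a + w
  bound : ∀ l < i, |accDiff q x y l| ≤ q * (t + 2 * s)
  blocks : (signBlocks (accDiff q x y) i).1 ≤ a + b + w
  -- One unit stays in reserve for opening a block of the sign dictated by the balance, unless the
  -- last block already has it.
  blocks_pos : i < j → 0 ≤ numNonzero x i - numNonzero y j →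
    (signBlocks (accDiff q x y) i).2 ≠ 1 → (signBlocks (accDiff q x y) i).1 + 1 ≤ a + b + w
  blocks_neg : i < j → numNonzero x i - numNonzero y j < 0 →
    (signBlocks (accDiff q x y) i).2 ≠ -1 → (signBlocks (accDiff q x y) i).1 + 1 ≤ a + b + w
  -- Where both symbols are non-zero, `F` may take either sign, which needs a further unit. At
  -- balance `-1` the counts agree at `i` and no sign is dictated, so that value is left out below.
  blocks_pending : Pending x y i j → (signBlocks (accDiff q x y) i).1 + 1 ≤ a + b + w ∧
    (0 ≤ numNonzero x i - numNonzero y j → (signBlocks (accDiff q x y) i).2 ≠ 1 →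
      (signBlocks (accDiff q x y) i).1 + 2 ≤ a + b + w) ∧
    (numNonzero x i - numNonzero y j < -1 → (signBlocks (accDiff q x y) i).2 ≠ -1 →
      (signBlocks (accDiff q x y) i).1 + 2 ≤ a + b + w)
  -- The deletion closing an offset keeps the sign of the balance or lifts it from `-1` to `0`,
  -- where matches give `F = 0`; no reserve is spent.
  sync : i = j → (signBlocks (accDiff q x y) i).1 + min a 1 ≤ a + b + w
  sync_pos : i = j → 0 < numNonzero x i - numNonzero y j →
    (signBlocks (accDiff q x y) i).2 ≠ 1 →
      (signBlocks (accDiff q x y) i).1 + min a 1 + 1 ≤ a + b + w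
  sync_neg : i = j → numNonzero x i - numNonzero y j < 0 →
    (signBlocks (accDiff q x y) i).2 ≠ -1 →
      (signBlocks (accDiff q x y) i).1 + min a 1 + 1 ≤ a + b + w

section

variable {q t s : ℕ} {x y : ℕ → ℕ} {i j a b w : ℕ}

/-- The lead can pass from one word to the other only at offset zero; there `a = b`, so `min a 1` is
symmetric. -/
theorem Inv.symm (h : Inv q t s x y i i a b w) : Inv q t s y x i i b a w := by
  obtain ⟨h1, h2, h3, h4, h5, h6, h7, h8, h9, h10, h11, h12, h13⟩ := h
  have hp : ¬ Pending y x i i := by rintro ⟨l, p, _, _, _, _⟩; omega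
  have hs := signBlocks_neg (accDiff q x y) i
  rw [← accDiff_swap] at hs
  have h11 := h11 rfl
  have h12 := h12 rfl
  have h13 := h13 rfl
  refine ⟨le_rfl, by omega, by omega, by omega, fun h => absurd h hp, ?_, by omega,
    fun h => by omega, fun h => by omega, fun h => absurd h hp, fun _ => by omega,
    fun _ => by omega, fun _ => by omega⟩
  intro l hl
  rw [accDiff_swap, abs_neg]
  exact h6 l hl

theorem bound_succ {F : ℕ → ℤ} {B : ℤ} (h : ∀ l < i, |F l| ≤ B) (hi : |F i| ≤ B) :
    ∀ l < i + 1, |F l| ≤ B := by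
  intro l hl
  rcases Nat.lt_succ_iff_lt_or_eq.mp hl with h' | rfl
  · exact h l h'
  · exact hi

theorem Pending.window (hy : Spaced t y) (h : Pending x y i j) (hj : j ≤ i + t) :
    numNonzero y j = numNonzero y i + 1 ∧ y j = 0 := by
  obtain ⟨l, p, hl, hlp, hpj, hxl, hyp⟩ := h
  rcases hy.window (by omega) hj with ⟨_, h'⟩ | ⟨h, h', _⟩
  · exact absurd (h' p (by omega) hpj) hyp
  · exact ⟨h, h'⟩

set_option maxHeartbeats 1000000 in
theorem Inv.same (h : Inv q t s x y i j a b w) (hxq : ∀ l, x l < q) (hyq : ∀ l, y l < q)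
    (hx : Spaced t x) (hy : Spaced t y) (hb : b ≤ t) (hw : w ≤ 2 * s) (hij : x i = y j) :
    Inv q t s x y (i + 1) (j + 1) a b w := by
  obtain ⟨h1, h2, h3, h4, h5, h6, h7, h8, h9, h10, h11, h12, h13⟩ := h
  have hp : Pending x y (i + 1) (j + 1) → Pending x y i j ∧ y i = 0 := by
    rintro ⟨l, p, hl, hlp, hpj, hxl, hyp⟩
    rcases Nat.lt_succ_iff_lt_or_eq.mp hpj with h | rfl
    · refine ⟨⟨l, p, by omega, hlp, h, hxl, hyp⟩, ?_⟩
      by_contra hyi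
      exact hyp (hy i p (by omega) (by omega) hyi)
    -- A match cannot create a pending pair: `x i = y p ≠ 0` and `x l ≠ 0` would be two non-zero
    -- symbols of `x` within distance `t`.
    · exact absurd (hx i l (by omega) (by omega) (by omega)) hxl
  have hB := signBlocks_succ (accDiff q x y) i
  have hF := accDiff_cases (hxq i) (hyq i)
  have hnx := numNonzero_succ x i
  have hny := numNonzero_succ y j
  have hW : (numNonzero y j = numNonzero y i ∧ (i < j → y i = 0)) ∨
      (numNonzero y j = numNonzero y i + 1 ∧ y j = 0 ∧ i < j) := by
    rcases hy.window h1 (by omega) with ⟨h, h'⟩ | ⟨h, h', p, _, _, _⟩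
    · exact Or.inl ⟨h, fun hlt => h' i le_rfl hlt⟩
    · exact Or.inr ⟨h, h', by omega⟩
  have hyj : i = j → y j = y i := fun h => h ▸ rfl
  have hK : |accDiff q x y i| ≤ q * (t + 2 * s) := by
    rcases h1.eq_or_lt with rfl | hlt
    · apply accDiff_abs_le (hxq i) (hyq i) <;> omega
    -- Now `a < b ≤ t`, which absorbs the possible non-zero symbol of the window.
    · apply accDiff_abs_le (hxq i) (hyq i) <;> omega
  refine ⟨by omega, by omega, by omega, by omega, fun h => ?_, bound_succ h6 hK, ?_, ?_, ?_,
    fun h => ?_, ?_, ?_, ?_⟩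
  · have := (hp h).1.window hy (by omega); have := h5 (hp h).1; omega
  · omega
  · omega
  · omega
  · have := (hp h).1.window hy (by omega); have := h10 (hp h).1; have := (hp h).2; omega
  · omega
  · omega
  · omega

set_option maxHeartbeats 1000000 in
theorem Inv.sub (h : Inv q t s x y i j a b w) (hxq : ∀ l, x l < q) (hyq : ∀ l, y l < q)
    (hy : Spaced t y) (hb : b ≤ t) (hw : w + 1 ≤ 2 * s) :
    Inv q t s x y (i + 1) (j + 1) a b (w + 1) := by
  obtain ⟨h1, h2, h3, h4, h5, h6, h7, h8, h9, h10, h11, h12, h13⟩ := h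
  have hp : Pending x y (i + 1) (j + 1) → (Pending x y i j ∧ y i = 0) ∨ (i < j ∧ y j ≠ 0) := by
    rintro ⟨l, p, hl, hlp, hpj, hxl, hyp⟩
    rcases Nat.lt_succ_iff_lt_or_eq.mp hpj with h | rfl
    · refine Or.inl ⟨⟨l, p, by omega, hlp, h, hxl, hyp⟩, ?_⟩
      by_contra hyi
      exact hyp (hy i p (by omega) (by omega) hyi)
    · exact Or.inr ⟨by omega, hyp⟩
  have hB := signBlocks_succ (accDiff q x y) i
  have hF := accDiff_cases (hxq i) (hyq i)
  have hnx := numNonzero_succ x i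
  have hny := numNonzero_succ y j
  have hyj : i = j → y j = y i := fun h => h ▸ rfl
  -- If `x i` and the window of `y` are both non-zero, the pair is pending with `l = i`, which
  -- releases the extra unit.
  have hW : (numNonzero y j = numNonzero y i ∧ (i < j → y i = 0)) ∨
      (numNonzero y j = numNonzero y i + 1 ∧ y j = 0 ∧ i < j ∧ (x i ≠ 0 → numNonzero x i - numNonzero y j + 1 ≤ a + w ∧
          (signBlocks (accDiff q x y) i).1 + 1 ≤ a + b + w)) := by
    rcases hy.window h1 (by omega) with ⟨h, h'⟩ | ⟨h, h', p, hp1, hp2, hp3⟩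
    · exact Or.inl ⟨h, fun hlt => h' i le_rfl hlt⟩
    · exact Or.inr ⟨h, h', by omega, fun hxi =>
        have hP : Pending x y i j := ⟨i, p, le_rfl, hp1, hp2, hxi, hp3⟩
        ⟨h5 hP, (h10 hP).1⟩⟩
  have hK : |accDiff q x y i| ≤ q * (t + 2 * s) := by
    rcases h1.eq_or_lt with rfl | hlt
    · apply accDiff_abs_le (hxq i) (hyq i) <;> omega
    · apply accDiff_abs_le (hxq i) (hyq i) <;> omega
  refine ⟨by omega, by omega, by omega, by omega, fun h => ?_, bound_succ h6 hK, ?_, ?_, ?_,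
    fun h => ?_, ?_, ?_, ?_⟩
  · rcases hp h with h | h
    · have := h.1.window hy (by omega); have := h5 h.1; rcases hW with hW | hW <;> rcases hB with hB | hB | hB <;> omega
    · rcases hW with hW | hW <;> rcases hB with hB | hB | hB <;> omega
  · rcases hW with hW | hW <;> rcases hB with hB | hB | hB <;> omega
  · rcases hW with hW | hW <;> rcases hB with hB | hB | hB <;> omega
  · rcases hW with hW | hW <;> rcases hB with hB | hB | hB <;> omega
  · rcases hp h with h | h
    · have := h.1.window hy (by omega); have := h10 h.1; have := h.2; rcases hW with hW | hW <;> rcases hB with hB | hB | hB <;> omega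
    · rcases hW with hW | hW <;> rcases hB with hB | hB | hB <;> omega
  · rcases hW with hW | hW <;> rcases hB with hB | hB | hB <;> omega
  · rcases hW with hW | hW <;> rcases hB with hB | hB | hB <;> omega
  · rcases hW with hW | hW <;> rcases hB with hB | hB | hB <;> omega

set_option maxHeartbeats 1000000 in
theorem Inv.delLeft (h : Inv q t s x y i j a b w) (hxq : ∀ l, x l < q) (hyq : ∀ l, y l < q)
    (hy : Spaced t y) (hb : b ≤ t) (hw : w ≤ 2 * s) (hij : i < j) :
    Inv q t s x y (i + 1) j (a + 1) b w := by
  obtain ⟨h1, h2, h3, h4, h5, h6, h7, h8, h9, h10, h11, h12, h13⟩ := h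
  have hp : Pending x y (i + 1) j → Pending x y i j ∧ y i = 0 := by
    rintro ⟨l, p, hl, hlp, hpj, hxl, hyp⟩
    refine ⟨⟨l, p, by omega, hlp, hpj, hxl, hyp⟩, ?_⟩
    by_contra hyi
    exact hyp (hy i p (by omega) (by omega) hyi)
  have hB := signBlocks_succ (accDiff q x y) i
  have hF := accDiff_cases (hxq i) (hyq i)
  have hnx := numNonzero_succ x i
  have hW : (numNonzero y j = numNonzero y i ∧ y i = 0) ∨
      (numNonzero y j = numNonzero y i + 1 ∧ y j = 0 ∧ (x i ≠ 0 → numNonzero x i - numNonzero y j + 1 ≤ a + w ∧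
          (signBlocks (accDiff q x y) i).1 + 1 ≤ a + b + w) ∧
        (j = i + 1 → y i ≠ 0)) := by
    rcases hy.window h1 (by omega) with ⟨h, h'⟩ | ⟨h, h', p, hp1, hp2, hp3⟩
    · exact Or.inl ⟨h, h' i le_rfl hij⟩
    · refine Or.inr ⟨h, h', fun hxi =>
        have hP : Pending x y i j := ⟨i, p, le_rfl, hp1, hp2, hxi, hp3⟩
        ⟨h5 hP, (h10 hP).1⟩, fun hj => ?_⟩
      obtain rfl : p = i := by omega
      exact hp3
  have hK : |accDiff q x y i| ≤ q * (t + 2 * s) := by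
    apply accDiff_abs_le (hxq i) (hyq i) <;> omega
  refine ⟨by omega, by omega, by omega, by omega, fun h => ?_, bound_succ h6 hK, ?_, ?_, ?_,
    fun h => ?_, ?_, ?_, ?_⟩
  · have := (hp h).1.window hy (by omega); have := h5 (hp h).1; rcases hW with hW | hW <;> rcases hB with hB | hB | hB <;> omega
  · rcases hW with hW | hW <;> rcases hB with hB | hB | hB <;> omega
  · rcases hW with hW | hW <;> rcases hB with hB | hB | hB <;> omega
  · rcases hW with hW | hW <;> rcases hB with hB | hB | hB <;> omega
  · have := (hp h).1.window hy (by omega); have := h10 (hp h).1; have := (hp h).2; rcases hW with hW | hW <;> rcases hB with hB | hB | hB <;> omega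
  · rcases hW with hW | hW <;> rcases hB with hB | hB | hB <;> omega
  · rcases hW with hW | hW <;> rcases hB with hB | hB | hB <;> omega
  · rcases hW with hW | hW <;> rcases hB with hB | hB | hB <;> omega

theorem Inv.delRight (h : Inv q t s x y i j a b w) : Inv q t s x y i (j + 1) a (b + 1) w := by
  obtain ⟨h1, h2, h3, h4, h5, h6, h7, h8, h9, h10, h11, h12, h13⟩ := h
  have hp : Pending x y i (j + 1) → Pending x y i j ∨ y j ≠ 0 := by
    rintro ⟨l, p, hl, hlp, hpj, hxl, hyp⟩
    rcases Nat.lt_succ_iff_lt_or_eq.mp hpj with h | rfl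
    · exact Or.inl ⟨l, p, by omega, hlp, h, hxl, hyp⟩
    · exact Or.inr hyp
  have hny := numNonzero_succ y j
  refine ⟨by omega, by omega, by omega, by omega, fun h => ?_, h6, by omega, ?_, ?_,
    fun h => ?_, by omega, by omega, by omega⟩
  · rcases hp h with h | h
    · have := h5 h; omega
    · omega
  · omega
  · omega
  · rcases hp h with h | h
    · have := h10 h; omega
    · omega

end

theorem Reach.inv {q t s : ℕ} {x y : ℕ → ℕ} (hxq : ∀ l, x l < q) (hyq : ∀ l, y l < q)
    (hx : Spaced t x) (hy : Spaced t y) {i j a b w : ℕ} (h : Reach x y i j a b w) :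
    a ≤ t → b ≤ t → w ≤ 2 * s → Inv q t s x y i j a b w ∨ Inv q t s y x j i b a w := by
  induction h with
  | start =>
    intro _ _ _
    left
    have hp : ¬ Pending x y 0 0 := by rintro ⟨l, p, _, _, _, _⟩; omega
    constructor <;> simp [numNonzero, signBlocks, hp]
  | same _ hij ih =>
    intro ha hb hw
    rcases ih ha hb hw with h | h
    · exact Or.inl (h.same hxq hyq hx hy hb hw hij)
    · exact Or.inr (h.same hyq hxq hy hx ha hw hij.symm)
  | sub _ ih =>
    intro ha hb hw
    rcases ih ha hb (by omega) with h | h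
    · exact Or.inl (h.sub hxq hyq hy hb hw)
    · exact Or.inr (h.sub hyq hxq hx ha hw)
  | delLeft _ ih =>
    intro ha hb hw
    rcases ih (by omega) hb hw with h | h
    · rcases h.le.eq_or_lt with rfl | hlt
      -- At offset zero this deletion puts `x` ahead, so the roles are exchanged.
      · exact Or.inr h.symm.delRight
      · exact Or.inl (h.delLeft hxq hyq hy hb hw hlt)
    · exact Or.inr h.delRight
  | delRight _ ih =>
    intro ha hb hw
    rcases ih ha (by omega) hw with h | h
    · exact Or.inl h.delRight
    · rcases h.le.eq_or_lt with rfl | hlt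
      · exact Or.inl h.symm.delRight
      · exact Or.inr (h.delLeft hyq hxq hx ha hw hlt)

/-! ### From error paths to alignments. -/

/-- `Alignment u v a b w`: the lists `u` and `v` have an alignment with `a` unmatched symbols of
`u`, `b` unmatched symbols of `v`, and at most `w` pairs of different symbols. -/
inductive Alignment {α : Type*} : List α → List α → ℕ → ℕ → ℕ → Prop
  | nil : Alignment [] [] 0 0 0
  | same {u v : List α} {a b w : ℕ} (c : α) :
      Alignment u v a b w → Alignment (c :: u) (c :: v) a b w
  | sub {u v : List α} {a b w : ℕ} (c d : α) :
      Alignment u v a b w → Alignment (c :: u) (d :: v) a b (w + 1)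
  | delLeft {u v : List α} {a b w : ℕ} (c : α) :
      Alignment u v a b w → Alignment (c :: u) v (a + 1) b w
  | delRight {u v : List α} {a b w : ℕ} (c : α) :
      Alignment u v a b w → Alignment u (c :: v) a (b + 1) w

namespace Alignment

variable {α : Type*}

theorem refl (u : List α) : Alignment u u 0 0 0 := by
  induction u with
  | nil => exact nil
  | cons c u ih => exact same c ih

theorem symm {u v : List α} {a b w : ℕ} (h : Alignment u v a b w) : Alignment v u b a w := by
  induction h with
  | nil => exact nil
  | same c _ ih => exact same c ih
  | sub c d _ ih => exact sub d c ih
  | delLeft c _ ih => exact delRight c ih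
  | delRight c _ ih => exact delLeft c ih

theorem insertLeft {u v z : List α} {a w : ℕ} (c : α) (h : Alignment (u ++ v) z a 0 w) :
    Alignment (u ++ c :: v) z (a + 1) 0 w := by
  induction u generalizing z a w with
  | nil => exact delLeft c h
  | cons d u ih =>
    cases h with
    | same _ h => exact same d (ih h)
    | sub _ e h => exact sub d e (ih h)
    | delLeft _ h => exact delLeft d (ih h)

/-- A symbol that is already mismatched or unmatched can be changed at no cost, hence only an
inequality. -/
theorem substLeft {u v z : List α} {a w : ℕ} (c d : α) (h : Alignment (u ++ d :: v) z a 0 w) :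
    ∃ w' ≤ w + 1, Alignment (u ++ c :: v) z a 0 w' := by
  induction u generalizing z a w with
  | nil =>
    cases h with
    | same _ h => exact ⟨_, le_rfl, sub c d h⟩
    | sub _ e h => exact ⟨_, by omega, sub c e h⟩
    | delLeft _ h => exact ⟨_, by omega, delLeft c h⟩
  | cons e u ih =>
    cases h with
    | same _ h =>
      obtain ⟨w', hw, h⟩ := ih h
      exact ⟨w', hw, same e h⟩
    | sub _ f h =>
      obtain ⟨w', hw, h⟩ := ih h
      exact ⟨w' + 1, by omega, sub e f h⟩
    | delLeft _ h =>
      obtain ⟨w', hw, h⟩ := ih h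
      exact ⟨w', hw, delLeft e h⟩

theorem trans {u v z : List α} {a b w w' : ℕ} (h : Alignment u z a 0 w)
    (h' : Alignment v z b 0 w') : ∃ w'' ≤ w + w', Alignment u v a b w'' := by
  generalize hk : (0 : ℕ) = k at h
  induction h generalizing v b w' with
  | nil => exact ⟨w', by omega, hk ▸ h'.symm⟩
  | same c _ ih =>
    -- Symbols of `v` unmatched in `z` have to be passed before the head of `z` is met.
    induction v generalizing b w' with
    | nil => cases h'
    | cons d v ihv =>
      cases h' with
      | same _ h' =>
        obtain ⟨w'', hw, h⟩ := ih h' hk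
        exact ⟨w'', hw, same c h⟩
      | sub _ _ h' =>
        obtain ⟨w'', hw, h⟩ := ih h' hk
        exact ⟨w'' + 1, by omega, sub c d h⟩
      | delLeft _ h' =>
        obtain ⟨w'', hw, h⟩ := ihv h'
        exact ⟨w'', hw, delRight d h⟩
  | sub c e _ ih =>
    induction v generalizing b w' with
    | nil => cases h'
    | cons d v ihv =>
      cases h' with
      | same _ h' =>
        obtain ⟨w'', hw, h⟩ := ih h' hk
        exact ⟨w'' + 1, by omega, sub c _ h⟩
      | sub _ _ h' =>
        obtain ⟨w'', hw, h⟩ := ih h' hk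
        exact ⟨w'' + 1, by omega, sub c d h⟩
      | delLeft _ h' =>
        obtain ⟨w'', hw, h⟩ := ihv h'
        exact ⟨w'', hw, delRight d h⟩
  | delLeft c _ ih =>
    obtain ⟨w'', hw, h⟩ := ih h' hk
    exact ⟨w'', hw, delLeft c h⟩
  | delRight c _ _ => omega

theorem reach {x y : ℕ → ℕ} (f : α → ℕ) {u v : List α} {a' b' w' : ℕ}
    (h : Alignment u v a' b' w') {i j a b w : ℕ} (hr : Reach x y i j a b w)
    (hx : ∀ l (hl : l < u.length), x (i + l) = f u[l])
    (hy : ∀ l (hl : l < v.length), y (j + l) = f v[l]) :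
    Reach x y (i + u.length) (j + v.length) (a + a') (b + b') (w + w') := by
  have tail {x : ℕ → ℕ} {i : ℕ} {c : α} {u : List α}
      (hx : ∀ l (hl : l < (c :: u).length), x (i + l) = f (c :: u)[l]) :
      ∀ l (hl : l < u.length), x (i + 1 + l) = f u[l] := fun l hl => by
    have := hx (l + 1) (by simpa using hl)
    rw [show i + 1 + l = i + (l + 1) by omega, this, List.getElem_cons_succ]
  induction h generalizing i j a b w with
  | nil => exact hr
  | same c _ ih =>
    have h0 := hx 0 (by simp)
    have h1 := hy 0 (by simp)
    have := ih (hr.same (by simpa using h0.trans h1.symm)) (tail hx) (tail hy)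
    convert this using 1 <;> (try rw [List.length_cons]) <;> omega
  | sub c d _ ih =>
    have := ih hr.sub (tail hx) (tail hy)
    convert this using 1 <;> (try rw [List.length_cons]) <;> omega
  | delLeft c _ ih =>
    have := ih hr.delLeft (tail hx) hy
    convert this using 1 <;> (try rw [List.length_cons]) <;> omega
  | delRight c _ ih =>
    have := ih hr.delRight hx (tail hy)
    convert this using 1 <;> (try rw [List.length_cons]) <;> omega

end Alignment

theorem ErrorPath.alignment {α : Type*} {t s : ℕ} {x z : List α} (h : ErrorPath t s x z) :
    ∃ w ≤ s, Alignment x z t 0 w := by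
  induction h with
  | refl x => exact ⟨0, le_rfl, Alignment.refl x⟩
  | deletion u v c _ ih =>
    obtain ⟨w, hw, h⟩ := ih
    exact ⟨w, hw, h.insertLeft c⟩
  | substitution u v c d _ ih =>
    obtain ⟨w, hw, h⟩ := ih
    obtain ⟨w', hw', h'⟩ := h.substLeft c d
    exact ⟨w', by omega, h'⟩

/-! ### Sign-matching polynomials and moments. -/

open Polynomial in
-- The first block takes a constant polynomial, and each further one a linear factor that changes
-- sign where the block starts. The last clause carries the sign past `m`, so that the current block
-- can be extended.
theorem exists_polynomial_sign (F : ℕ → ℤ) (m : ℕ) :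
    ((signBlocks F m).1 = 0 ∧ (signBlocks F m).2 = 0 ∧ ∀ i < m, F i = 0) ∨
    (((signBlocks F m).2 = 1 ∨ (signBlocks F m).2 = -1) ∧
      ∃ P : ℤ[X], P.natDegree + 1 ≤ (signBlocks F m).1 ∧
        (∀ i < m, F i ≠ 0 → 0 < F i * P.eval ((i : ℤ) + 1)) ∧
        ∀ i ≥ m, 0 < (signBlocks F m).2 * P.eval ((i : ℤ) + 1)) := by
  induction m with
  | zero => left; simp [signBlocks]
  | succ m ih =>
    have hm := signBlocks_succ F m
    generalize (signBlocks F (m + 1)).1 = A' at *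
    generalize (signBlocks F (m + 1)).2 = c' at *
    generalize (signBlocks F m).1 = A at *
    generalize (signBlocks F m).2 = c at *
    have hcases : (F m = 0 ∨ (c ≠ 0 ∧ 0 < c * F m)) ∧ A' = A ∧ c' = c ∨
        c = 0 ∧ 0 < c' * F m ∧ A' = A + 1 ∧ (c' = 1 ∨ c' = -1) ∨
        c ≠ 0 ∧ 0 < c' * F m ∧ A' = A + 1 ∧ c' = -c := by
      have hc : c = 0 ∨ c = 1 ∨ c = -1 := by
        rcases ih with h | h
        · exact Or.inl h.2.1
        · exact Or.inr h.1
      rcases hm with h | ⟨h, rfl, h'⟩ | ⟨h, rfl, h'⟩ <;> rcases hc with rfl | rfl | rfl <;> omega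
    rcases hcases with ⟨h0, rfl, rfl⟩ | ⟨h0, h1, rfl, h2⟩ | ⟨h0, h1, rfl, rfl⟩
    · rcases ih with ⟨ha, hc, hF⟩ | ⟨hc, P, hd, hP, hs⟩
      · left
        refine ⟨ha, hc, fun i hi => ?_⟩
        rcases Nat.lt_succ_iff_lt_or_eq.mp hi with h | rfl
        · exact hF i h
        · simpa [hc] using h0
      · right
        refine ⟨hc, P, hd, fun i hi hFi => ?_, fun i hi => hs i (by omega)⟩
        rcases Nat.lt_succ_iff_lt_or_eq.mp hi with h | rfl
        · exact hP i h hFi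
        · have h1 := hs i le_rfl
          rcases h0 with h0 | ⟨_, h0⟩
          · exact absurd h0 hFi
          · rcases hc with rfl | rfl <;> nlinarith
    · rcases ih with ⟨ha, hc, hF⟩ | ⟨hc, _⟩
      · right
        refine ⟨h2, C c', by simp, fun i hi hFi => ?_, fun i _ => ?_⟩
        · rcases Nat.lt_succ_iff_lt_or_eq.mp hi with h | rfl
          · exact absurd (hF i h) hFi
          · rw [eval_C, mul_comm]; exact h1
        · rw [eval_C]; rcases h2 with rfl | rfl <;> norm_num
      · omega
    · rcases ih with ⟨_, hc, _⟩ | ⟨hc, P, hd, hP, hs⟩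
      · exact absurd hc h0
      · right
        -- The root `m + 1/2` lies between positions `m` and `m + 1`, that is, indices `m - 1` and
        -- `m`; doubling keeps the coefficients integral.
        have hev (i : ℕ) : (P * (C (2 * (m : ℤ) + 1) - C 2 * X)).eval ((i : ℤ) + 1) =
            P.eval ((i : ℤ) + 1) * (2 * (m - i) - 1) := by
          simp only [eval_mul, eval_sub, eval_C, eval_X]; ring
        refine ⟨by omega, P * (C (2 * (m : ℤ) + 1) - C 2 * X), ?_, fun i hi hFi => ?_,
          fun i hi => ?_⟩
        · have h1 : (C (2 * (m : ℤ) + 1) - C 2 * X : ℤ[X]).natDegree ≤ 1 := by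
            compute_degree
          have := natDegree_mul_le (p := P) (q := C (2 * (m : ℤ) + 1) - C 2 * X)
          omega
        · rw [hev, ← mul_assoc]
          rcases Nat.lt_succ_iff_lt_or_eq.mp hi with h | rfl
          · exact mul_pos (hP i h hFi) (by omega)
          · have h2 := hs i le_rfl
            rcases hc with rfl | rfl <;> nlinarith
        · have h2 := hs i (by omega)
          rw [hev, show -c * (P.eval ((i : ℤ) + 1) * (2 * ((m : ℤ) - i) - 1)) =
            c * P.eval ((i : ℤ) + 1) * (2 * (i - m) + 1) by ring]
          exact mul_pos h2 (by omega)

open Polynomial in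
/-- A sequence with `A` sign blocks vanishes if its moments of orders less than `A` do. -/
theorem eq_zero_of_moments {F : ℕ → ℤ} {n A : ℕ} (hA : (signBlocks F n).1 ≤ A)
    (h : ∀ k < A, ∑ i ∈ Finset.range n, ((i : ℤ) + 1) ^ k * F i = 0) : ∀ i < n, F i = 0 := by
  rcases exists_polynomial_sign F n with ⟨_, _, h0⟩ | ⟨_, P, hd, hP, _⟩
  · exact h0
  · have hsum : ∑ i ∈ Finset.range n, F i * P.eval ((i : ℤ) + 1) = 0 := by
      simp only [eval_eq_sum_range, Finset.mul_sum]
      rw [Finset.sum_comm]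
      refine Finset.sum_eq_zero fun k hk => ?_
      rw [Finset.mem_range] at hk
      have := h k (by omega)
      rw [← mul_zero (P.coeff k), ← this, Finset.mul_sum]
      exact Finset.sum_congr rfl fun i _ => by ring
    have hnn : ∀ i ∈ Finset.range n, 0 ≤ F i * P.eval ((i : ℤ) + 1) := fun i hi => by
      by_cases hFi : F i = 0
      · simp [hFi]
      · exact (hP i (Finset.mem_range.mp hi) hFi).le
    intro i hi
    by_contra hFi
    have := (Finset.sum_eq_zero_iff_of_nonneg hnn).mp hsum i (Finset.mem_range.mpr hi)
    exact absurd this (hP i hi hFi).ne'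

/-! ### Codewords as zero-padded functions. -/

/-- The sequence `x` continued by zeros. -/
def padded {q n : ℕ} (x : Fin n → Fin q) (l : ℕ) : ℕ := if h : l < n then x ⟨l, h⟩ else 0

theorem padded_val {q n : ℕ} (x : Fin n → Fin q) (i : Fin n) : padded x i = x i := by
  simp [padded]

theorem padded_lt {q n : ℕ} (hq : 0 < q) (x : Fin n → Fin q) (l : ℕ) : padded x l < q := by
  unfold padded
  split_ifs
  · exact Fin.is_lt _
  · exact hq

/-- Validity restricts only adjacent non-zero entries; by strong induction everything strictly
between `i` and `j` is zero, so the two would be adjacent. -/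
theorem IsValid.spaced {q n t : ℕ} {x : Fin n → Fin q} (h : IsValid t x) :
    Spaced t (padded x) := by
  intro i j hij hj hi
  induction j using Nat.strong_induction_on with
  | _ j ih =>
    by_contra hj0
    have hin : i < n := by by_contra hn; simp [padded, hn] at hi
    have hjn : j < n := by by_contra hn; simp [padded, hn] at hj0
    have := h ⟨i, hin⟩ ⟨j, hjn⟩ hij (by simpa [padded, hin] using hi)
      (by simpa [padded, hjn] using hj0) (fun l hl1 hl2 => by
        rw [← padded_val]; exact ih l hl2 hl1 (by have : (l : ℕ) < j := hl2; omega))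
    simp only at this
    omega

/-- As `t ≥ 1`, a non-zero symbol `c` sits between zeros: it contributes `c` at its own position and
`q - c` at the next. -/
theorem accDiffSeq_eq {q n t : ℕ} (ht : 1 ≤ t) {x : Fin n → Fin q} (h : IsValid t x) (i : Fin n) :
    accDiffSeq x i = padded x i + q * numNonzero (padded x) i := by
  obtain ⟨i, hi⟩ := i
  have hlt (i) (hi : i < n) : (((x ⟨i, hi⟩ : Fin q) : ℕ) : ℤ) < q := by exact_mod_cast Fin.is_lt _
  induction i with
  | zero =>
    have : Finset.Iic (⟨0, hi⟩ : Fin n) = {⟨0, hi⟩} := by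
      ext j; simp [Fin.le_def, Fin.ext_iff]
    rw [accDiffSeq, this, Finset.sum_singleton]
    simp [diffSeq, prevSymbol, numNonzero, padded, hi, Int.emod_eq_of_lt, hlt]
  | succ i ih =>
    have hset : Finset.Iic (⟨i + 1, hi⟩ : Fin n) =
        insert ⟨i + 1, hi⟩ (Finset.Iic ⟨i, by omega⟩) := by
      ext j; simp only [Finset.mem_Iic, Finset.mem_insert, Fin.le_def, Fin.ext_iff]; omega
    have ih := ih (by omega)
    rw [accDiffSeq] at ih ⊢
    rw [hset, Finset.sum_insert (by simp [Fin.le_def]), ih]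
    have hs := h.spaced i (i + 1) (by omega) (by omega)
    have hd : diffSeq x ⟨i + 1, hi⟩ = ((padded x (i + 1) : ℤ) - padded x i) % q := by
      simp [diffSeq, prevSymbol, padded, hi, show i < n by omega]
    have h1 := padded_lt (Fin.pos (x ⟨i, by omega⟩)) x (i + 1)
    have h2 := padded_lt (Fin.pos (x ⟨i, by omega⟩)) x i
    rw [hd]
    simp only
    rcases numNonzero_succ (padded x) i with ⟨h0, h3⟩ | ⟨h0, h3⟩
    · rw [h3, h0, Nat.cast_zero, sub_zero, Int.emod_eq_of_lt (by omega) (by omega)]; ring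
    · rw [h3, hs h0, Nat.cast_zero, zero_sub, ← Int.add_emod_right,
        Int.emod_eq_of_lt (by omega) (by omega)]
      ring

/-- Modulo `q` only `x i - y i` survives. -/
theorem eq_of_accDiff_eq_zero {q n : ℕ} {x y : Fin n → Fin q}
    (h : ∀ i < n, accDiff q (padded x) (padded y) i = 0) : x = y := by
  funext i
  have hi := h i i.2
  rw [accDiff, padded_val, padded_val] at hi
  have h1 : (((x i : ℕ) : ℤ)) ≡ ((y i : ℕ) : ℤ) [ZMOD q] := by
    rw [Int.modEq_comm, Int.modEq_iff_dvd]
    exact ⟨-(numNonzero (padded x) i - numNonzero (padded y) i), by linarith⟩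
  rw [Int.natCast_modEq_iff] at h1
  exact Fin.ext (h1.eq_of_lt_of_lt (x i).2 (y i).2)

end DelSub

theorem mainTheorem6 (q n t s : ℕ) (hq : 2 ≤ q) (ht : 1 ≤ t) (a : ℕ → ℕ)
    (ha : ∀ k ∈ Finset.Icc 0 (2 * t + 2 * s - 2), a k ≤ DelSub.nBound q n t s k) :
    DelSub.IsCorrectingCode t s (DelSub.validVTCode q n t s a) := by
  open DelSub in
  intro x hx y hy hne
  rw [Set.disjoint_left]
  intro z hxz hyz
  obtain ⟨w₁, hw₁, h₁⟩ := ErrorPath.alignment hxz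
  obtain ⟨w₂, hw₂, h₂⟩ := ErrorPath.alignment hyz
  obtain ⟨w, hw, h⟩ := h₁.trans h₂
  have hr := h.reach (x := padded x) (y := padded y) (Fin.val : Fin q → ℕ) Reach.start
    (by intro l hl; rw [List.length_ofFn] at hl; simp [padded, hl])
    (by intro l hl; rw [List.length_ofFn] at hl; simp [padded, hl])
  simp only [List.length_ofFn, zero_add] at hr
  have hI : Inv q t s (padded x) (padded y) n n t t w := by
    rcases hr.inv (padded_lt (by omega) x) (padded_lt (by omega) y) hx.1.spaced hy.1.spaced le_rfl
      le_rfl (s := s) (by omega) with h | h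
    · exact h
    · exact h.symm
  have hA : (signBlocks (accDiff q (padded x) (padded y)) n).1 ≤ 2 * t + 2 * s - 1 := by
    -- As `t ≥ 1`, `min t 1 = 1`: the saved unit turns `2t + 2s` into `2t + 2s - 1`.
    have := hI.sync rfl
    omega
  refine hne (eq_of_accDiff_eq_zero (eq_zero_of_moments hA fun k hk => ?_))
  have hk' : k ∈ Finset.Icc 0 (2 * t + 2 * s - 2) := Finset.mem_Icc.mpr ⟨by omega, by omega⟩
  have hdvd := ((hy.2 k hk').trans (hx.2 k hk').symm).dvd
  have hsum : vtSyndrome k (accDiffSeq x) - vtSyndrome k (accDiffSeq y) =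
      ∑ i ∈ Finset.range n, ((i : ℤ) + 1) ^ k * accDiff q (padded x) (padded y) i := by
    rw [vtSyndrome, vtSyndrome, ← Finset.sum_sub_distrib, ← Fin.sum_univ_eq_sum_range
      (fun i => ((i : ℤ) + 1) ^ k * accDiff q (padded x) (padded y) i)]
    refine Finset.sum_congr rfl fun i _ => ?_
    rw [accDiffSeq_eq ht hx.1, accDiffSeq_eq ht hy.1, accDiff]
    ring
  rw [hsum] at hdvd
  -- The modulus exceeds `n_k`, so a multiple of absolute value at most `n_k` is zero.
  refine Int.eq_zero_of_abs_lt_dvd hdvd (lt_of_le_of_lt ?_ (Int.ofNat_lt.mpr (Nat.lt_succ_self _)))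
  calc _ ≤ ∑ i ∈ Finset.range n, |((i : ℤ) + 1) ^ k * accDiff q (padded x) (padded y) i| :=
        Finset.abs_sum_le_sum_abs _ _
    _ ≤ ∑ i ∈ Finset.range n, ((i : ℤ) + 1) ^ k * (q * (2 * t + 2 * s - 1)) := by
        refine Finset.sum_le_sum fun i hi => ?_
        rw [abs_mul, abs_of_nonneg (by positivity)]
        have h1 := hI.bound i (Finset.mem_range.mp hi)
        have h2 : (q : ℤ) * (t + 2 * s) ≤ q * (2 * t + 2 * s - 1) := by gcongr; omega
        gcongr
        exact h1.trans h2
    _ = (nBound q n t s k : ℤ) := by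
        rw [nBound, ← Finset.sum_mul, mul_comm, ← Finset.Ico_add_one_right_eq_Icc,
          Finset.sum_Ico_eq_sum_range, Nat.add_sub_cancel]
        push_cast [Nat.cast_sub (show 1 ≤ 2 * t + 2 * s by omega)]
        simp only [add_comm]
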